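/- Let $G$ be a finite simple connected graph with $n$ vertices and $m$ edges. Its cyclomatic number is $m-n+1$, and $G$ is called $5$-cyclic if this number equals $5$. An edge-coloring of $G$ with $q$ colors is any map from the edge set of $G$ to a set of $q$ colors (adjacent edges may have the same color). A rainbow tree is a subgraph of $G$ that is a tree and in which no two edges have the same color. The $3$-rainbow index $rx_3(G)$ is the smallest $q$ for which $G$ has an edge-coloring with $q$ colors such that every set of three vertices of $G$ is contained in the vertex set of some rainbow tree. Let $K_5-e$ denote the complete graph on five vertices with one edge removed. If $G$ is a connected $5$-cyclic graph of order $n$, then $rx_3(G)=n-2$ if and only if $G$ is isomorphic to $K_5-e$. -/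

import Mathlib

namespace SimpleGraph

variable {V : Type*}

/-- An edge-coloring `c` of `G` with `q` colors (adjacent edges may share a color) is a
`k`-rainbow coloring if every `k`-set `S` of vertices is contained in the vertex set of a
subgraph `T` of `G` that is a tree no two of whose edges have the same color. -/
def IsRainbowColoring (G : SimpleGraph V) (k : ℕ) {q : ℕ} (c : G.edgeSet → Fin q) : Prop :=
  ∀ S : Finset V, S.card = k →
    ∃ T : G.Subgraph, T.coe.IsTree ∧ (∀ v ∈ S, v ∈ T.verts) ∧
      ∀ e f : G.edgeSet, (e : Sym2 V) ∈ T.edgeSet → (f : Sym2 V) ∈ T.edgeSet →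
        c e = c f → e = f

/-- The `k`-rainbow index `rx_k(G)`: the minimum number of colors in a `k`-rainbow coloring. -/
noncomputable def rainbowIndex (G : SimpleGraph V) (k : ℕ) : ℕ :=
  sInf {q : ℕ | ∃ c : G.edgeSet → Fin q, G.IsRainbowColoring k c}

/-- The cyclomatic number `m - n + 1` of a finite graph with `n` vertices and `m` edges. -/
noncomputable def cyclomaticNumber (G : SimpleGraph V) : ℤ :=
  (Nat.card G.edgeSet : ℤ) - (Nat.card V : ℤ) + 1

/-- The graph `K_5 - e`: the complete graph on five vertices with one edge removed. -/
def completeFiveMinusEdge : SimpleGraph (Fin 5) :=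
  (⊤ : SimpleGraph (Fin 5)).deleteEdges {s(0, 1)}

end SimpleGraph

/-! The theorem reduces to two facts. A connected graph with n ≥ 6 and m ≥ n + 4 has a rainbow
coloring with n - 3 colors (`Connected.rainbowOn_univ`), while `K_5 - e` has index exactly 3. Since
m = n + 4 is impossible for n < 5 and forces `K_5 - e` for n = 5, both directions follow.

Upper bound: undoing the contraction of an edge costs one color (`RainbowOn.of_contract`), and so
does attaching a new vertex. Hence a subgraph on k vertices that is colored with k - 3 colors gives
n - 3 colors for the whole connected graph (`RainbowOn.univ`). Contracting an edge in no triangle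
removes one vertex and one edge, so induction on n leaves graphs on six vertices and graphs on at
least seven vertices whose edges all lie in triangles. In the latter, a triangle can be grown step
by step, by connectedness and the triangle condition, until one of finitely many "saving patterns"
appears (`growingPatterns_closed`). On six vertices, ten edges give a vertex of degree at least
four, hence one of two spanning trees; at most five pairs are non-edges, and a finite branching over
the pairs finds a saving pattern (`sixVertexTrees_forced`). The finite checks are evaluated by the
kernel.

Lower bound: with two colors, every triple must be spanned by a two-edge path of distinct colors,
and pigeonhole on the three common neighbors of the missing edge's ends rules this out. -/

namespace SimpleGraph

/-! ### Rainbow colorings under contraction and growth -/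

/-- The vertices of `U` are joined in triples by subgraphs of `G` living inside `U` whose edges
have distinct colors less than `q`. -/
def RainbowOn {V : Type*} (G : SimpleGraph V) (U : Finset V) (q : ℕ) : Prop :=
  ∃ c : Sym2 V → ℕ, ∀ a ∈ U, ∀ b ∈ U, ∀ d ∈ U, ∃ H ≤ G, (∀ ⦃u v⦄, H.Adj u v → u ∈ U) ∧
    (∀ e ∈ H.edgeSet, c e < q) ∧ Set.InjOn c H.edgeSet ∧ H.Reachable a b ∧ H.Reachable a d

/-- Undoing the contraction of an edge `ab` costs at most one color. -/
theorem RainbowOn.of_contract {V W : Type*} {G : SimpleGraph V} {G' : SimpleGraph W}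
    {U : Finset V} {U' : Finset W} {q : ℕ} (h : G'.RainbowOn U' q) (f : V → W) {a b : V}
    (hab : G.Adj a b) (ha : a ∈ U) (hb : b ∈ U) (hf : f a = f b)
    (hfib : ∀ u ∈ U, ∀ v ∈ U, f u = f v → u = v ∨ s(u, v) = s(a, b))
    (hU : ∀ u ∈ U, f u ∈ U')
    (hlift : ∀ p ∈ U', ∀ r ∈ U', G'.Adj p r → ∃ u ∈ U, ∃ v ∈ U, f u = p ∧ f v = r ∧ G.Adj u v) :
    G.RainbowOn U (q + 1) := by
  classical
  obtain ⟨c, hc⟩ := h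
  -- The contracted edge gets the fresh color `q`; every other edge inherits the color of its image.
  refine ⟨fun e => if e = s(a, b) then q else c (e.map f), fun x hx y hy z hz => ?_⟩
  obtain ⟨H', hH'G, hH'U, hlt, hinj, hxy, hxz⟩ := hc _ (hU x hx) _ (hU y hy) _ (hU z hz)
  have hex : ∀ e : Sym2 W, ∃ e' : Sym2 V, e ∈ H'.edgeSet →
      e' ∈ G.edgeSet ∧ e'.map f = e ∧ ∀ v ∈ e', v ∈ U := by
    intro e
    by_cases he : e ∈ H'.edgeSet
    · induction e using Sym2.ind with
      | _ p r =>
        have hpr : H'.Adj p r := he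
        obtain ⟨u, hu, v, hv, h1, h2, h3⟩ := hlift p (hH'U hpr) r (hH'U hpr.symm) (hH'G hpr)
        refine ⟨s(u, v), fun _ => ⟨h3, by simp [h1, h2], ?_⟩⟩
        intro w hw
        rcases Sym2.mem_iff.1 hw with rfl | rfl <;> assumption
    · exact ⟨s(a, b), fun h => absurd h he⟩
  choose g hg using hex
  have hgne : ∀ e ∈ H'.edgeSet, g e ≠ s(a, b) := by
    intro e he h
    have h1 := (hg e he).2.1
    rw [h, Sym2.map_mk] at h1
    subst h1
    exact H'.not_isDiag_of_mem_edgeSet he (by simpa using hf)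
  -- Edges with the same image share a color, so only one lift of each edge of `H'` is taken. Adding
  -- `ab` connects the fibers.
  set S : Set (Sym2 V) := insert s(a, b) (g '' H'.edgeSet) with hS
  have hSG : S ⊆ G.edgeSet := by
    rintro e (rfl | ⟨e', he', rfl⟩)
    · exact hab
    · exact (hg e' he').1
  have hSU : ∀ e ∈ S, ∀ v ∈ e, v ∈ U := by
    rintro e (rfl | ⟨e', he', rfl⟩) v hv
    · rcases Sym2.mem_iff.1 hv with rfl | rfl <;> assumption
    · exact (hg e' he').2.2 v hv
  have hedge : (fromEdgeSet S).edgeSet = S := by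
    rw [edgeSet_fromEdgeSet]
    ext e
    refine ⟨fun h => h.1, fun h => ⟨h, fun h' => G.not_isDiag_of_mem_edgeSet (hSG h) h'⟩⟩
  have hfibr : ∀ u ∈ U, ∀ v ∈ U, f u = f v → (fromEdgeSet S).Reachable u v := by
    intro u hu v hv huv
    rcases hfib u hu v hv huv with rfl | h
    · exact Reachable.refl _
    · refine Adj.reachable ?_
      rw [← mem_edgeSet, hedge, h]
      exact Set.mem_insert _ _
  have hreach : ∀ p r, H'.Reachable p r → ∀ u ∈ U, ∀ v ∈ U, f u = p → f v = r →
      (fromEdgeSet S).Reachable u v := by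
    rintro p r ⟨w⟩
    induction w with
    | nil =>
      intro u hu v hv h1 h2
      exact hfibr u hu v hv (h1.trans h2.symm)
    | @cons p s r hps w ih =>
      intro u hu v hv h1 h2
      obtain ⟨hG, hmap, hmem⟩ := hg s(p, s) hps
      have hmS : g s(p, s) ∈ S := Or.inr ⟨_, hps, rfl⟩
      generalize g s(p, s) = e at hG hmap hmem hmS
      have key : ∀ u₀ v₀, e = s(u₀, v₀) → f u₀ = p → f v₀ = s →
          (fromEdgeSet S).Reachable u v := by
        intro u₀ v₀ he h3 h4
        subst he
        have hu₀ : u₀ ∈ U := hmem _ (by simp)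
        have hv₀ : v₀ ∈ U := hmem _ (by simp)
        have hadj : (fromEdgeSet S).Adj u₀ v₀ := by
          rw [← mem_edgeSet, hedge]
          exact hmS
        exact (hfibr u hu u₀ hu₀ (h1.trans h3.symm)).trans
          (hadj.reachable.trans (ih v₀ hv₀ v hv h4 h2))
      induction e using Sym2.ind with
      | _ u₀ v₀ =>
        rw [Sym2.map_mk, Sym2.eq_iff] at hmap
        rcases hmap with ⟨h3, h4⟩ | ⟨h3, h4⟩
        · exact key u₀ v₀ rfl h3 h4
        · exact key v₀ u₀ Sym2.eq_swap h4 h3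
  refine ⟨fromEdgeSet S, ?_, ?_, ?_, ?_, hreach _ _ hxy x hx y hy rfl rfl,
    hreach _ _ hxz x hx z hz rfl rfl⟩
  · intro u v huv
    rw [← mem_edgeSet, hedge] at huv
    exact hSG huv
  · intro u v huv
    rw [← mem_edgeSet, hedge] at huv
    exact hSU _ huv u (by simp)
  · rw [hedge]
    rintro e (rfl | ⟨e', he', rfl⟩)
    · simp
    · simp only [hgne e' he', if_false, (hg e' he').2.1]
      exact (hlt e' he').trans (Nat.lt_succ_self q)
  · rw [hedge]
    rintro e (rfl | ⟨e₁, he₁, rfl⟩) e' (rfl | ⟨e₂, he₂, rfl⟩) hee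
    · rfl
    · simp only [if_true, hgne e₂ he₂, if_false, (hg e₂ he₂).2.1] at hee
      exact absurd hee (hlt e₂ he₂).ne'
    · simp only [if_true, hgne e₁ he₁, if_false, (hg e₁ he₁).2.1] at hee
      exact absurd hee (hlt e₁ he₁).ne
    · simp only [hgne e₁ he₁, hgne e₂ he₂, if_false, (hg e₁ he₁).2.1, (hg e₂ he₂).2.1] at hee
      rw [hinj he₁ he₂ hee]

/-- Folding `x` onto its neighbor `u` is a contraction of `ux` in the sense of
`RainbowOn.of_contract`, with `G` itself as the target graph. -/
theorem RainbowOn.insert_vertex {V : Type*} [DecidableEq V] {G : SimpleGraph V} {U : Finset V} {q : ℕ}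
    (h : G.RainbowOn U q) {u x : V} (hu : u ∈ U) (hx : x ∉ U) (hux : G.Adj u x) :
    G.RainbowOn (insert x U) (q + 1) := by
  have hid : ∀ v ∈ U, (if v = x then u else v) = v := fun v hv =>
    if_neg (by rintro rfl; exact hx hv)
  refine h.of_contract (fun v => if v = x then u else v) hux (Finset.mem_insert_of_mem hu)
    (Finset.mem_insert_self _ _) (by simp) ?_ ?_ ?_
  · intro v hv w hw hvw
    rcases Finset.mem_insert.1 hv with rfl | hv' <;> rcases Finset.mem_insert.1 hw with rfl | hw'
    · exact Or.inl rfl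
    · simp only [if_true, hid w hw'] at hvw
      exact Or.inr (by rw [hvw, Sym2.eq_swap])
    · simp only [if_true, hid v hv'] at hvw
      exact Or.inr (by rw [hvw])
    · simp only [hid v hv', hid w hw'] at hvw
      exact Or.inl hvw
  · intro v hv
    rcases Finset.mem_insert.1 hv with rfl | hv
    · simpa using hu
    · simpa only [hid v hv] using hv
  · intro p hp r hr hpr
    exact ⟨p, Finset.mem_insert_of_mem hp, r, Finset.mem_insert_of_mem hr, hid p hp, hid r hr, hpr⟩

theorem Connected.exists_adj_not_mem {V : Type*} {G : SimpleGraph V} (hG : G.Connected)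
    {U : Set V} (hne : U.Nonempty) (hU : U ≠ Set.univ) : ∃ u ∈ U, ∃ x ∉ U, G.Adj u x := by
  obtain ⟨a, ha⟩ := hne
  obtain ⟨b, hb⟩ := (Set.ne_univ_iff_exists_notMem U).1 hU
  obtain ⟨w⟩ := hG a b
  obtain ⟨d, _, h1, h2⟩ := w.exists_boundary_dart U ha hb
  exact ⟨d.fst, h1, d.snd, h2, d.adj⟩

/-- Connectedness always supplies an edge leaving `U`, so the set grows one vertex and one color at
a time; the number of colors saved never decreases. -/
theorem RainbowOn.univ {V : Type*} [Fintype V] {G : SimpleGraph V} (hG : G.Connected)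
    {U : Finset V} (hne : U.Nonempty) {q : ℕ} (h : G.RainbowOn U q) :
    G.RainbowOn Finset.univ (q + (Fintype.card V - U.card)) := by
  classical
  obtain ⟨k, hk⟩ : ∃ k, k = Fintype.card V - U.card := ⟨_, rfl⟩
  induction k generalizing U q with
  | zero =>
    have hU : U = Finset.univ := by
      rw [← Finset.card_eq_iff_eq_univ]
      exact le_antisymm (Finset.card_le_univ U) (by omega)
    subst hU
    simpa using h
  | succ k ih =>
    obtain ⟨u, hu, x, hx, hux⟩ := hG.exists_adj_not_mem (U := (U : Set V)) (by simpa using hne)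
      (fun h => by
        rw [Finset.coe_eq_univ] at h
        subst h
        simp at hk)
    have hcard := Finset.card_insert_of_notMem (s := U) (a := x) (by simpa using hx)
    have := ih (Finset.insert_nonempty x U) (h.insert_vertex (by simpa using hu) (by simpa using hx) hux)
      (by omega)
    convert this using 1
    omega


theorem RainbowOn.exists_isRainbowColoring {V : Type*} [Fintype V] {G : SimpleGraph V} {q : ℕ}
    (h : G.RainbowOn Finset.univ q) (hq : 0 < q) :
    ∃ c : G.edgeSet → Fin q, G.IsRainbowColoring 3 c := by
  classical
  obtain ⟨c, hc⟩ := h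
  -- Colors not below `q` never occur on the subgraphs in use, so they may be replaced by 0.
  refine ⟨fun e => if h : c e < q then ⟨c e, h⟩ else ⟨0, hq⟩, fun S hS => ?_⟩
  obtain ⟨a, b, d, -, -, -, rfl⟩ := Finset.card_eq_three.1 hS
  obtain ⟨H, hHG, -, hlt, hinj, hab, had⟩ :=
    hc a (Finset.mem_univ _) b (Finset.mem_univ _) d (Finset.mem_univ _)
  set C := H.connectedComponentMk a with hC
  -- `H` may have cycles and further components; a spanning tree of the component of `a` suffices.
  obtain ⟨T, hTle, hT⟩ := C.connected_toSimpleGraph.exists_isTree_le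
  let T' : G.Subgraph :=
    { verts := C.supp
      Adj := fun u v => ∃ hu hv, T.Adj ⟨u, hu⟩ ⟨v, hv⟩
      adj_sub := fun ⟨_, _, h⟩ => hHG (hTle h)
      edge_vert := fun ⟨hu, _, _⟩ => hu
      symm := ⟨fun _ _ ⟨hu, hv, h⟩ => ⟨hv, hu, h.symm⟩⟩ }
  have hT' : T'.coe = T := by
    ext u v
    exact ⟨fun ⟨_, _, h⟩ => h, fun h => ⟨u.2, v.2, h⟩⟩
  have hsub : ∀ e ∈ T'.edgeSet, e ∈ H.edgeSet := by
    intro e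
    induction e using Sym2.ind with
    | _ u v => exact fun ⟨_, _, h⟩ => hTle h
  refine ⟨T', ?_, ?_, ?_⟩
  · rw [hT']
    exact hT
  · intro v hv
    change v ∈ C.supp
    rw [ConnectedComponent.mem_supp_iff, hC, ConnectedComponent.eq]
    simp only [Finset.mem_insert, Finset.mem_singleton] at hv
    rcases hv with rfl | rfl | rfl
    · exact Reachable.refl _
    · exact hab.symm
    · exact had.symm
  · intro e f he hf hef
    have he' := hsub _ he
    have hf' := hsub _ hf
    simp only [hlt _ he', hlt _ hf', dif_pos, Fin.mk.injEq] at hef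
    exact Subtype.ext (hinj he' hf' hef)

theorem RainbowOn.rainbowIndex_le {V : Type*} [Fintype V] {G : SimpleGraph V} {q : ℕ}
    (h : G.RainbowOn Finset.univ q) (hq : 0 < q) : G.rainbowIndex 3 ≤ q :=
  Nat.sInf_le (h.exists_isRainbowColoring hq)

/-! ### Contracting an edge -/

/-- The map that identifies `b` with `a`. -/
noncomputable def collapse {V : Type*} {a b : V} (hab : a ≠ b) (v : V) : {v : V // v ≠ b} :=
  open Classical in if h : v = b then ⟨a, hab⟩ else ⟨v, h⟩

theorem collapse_eq_collapse {V : Type*} {a b : V} (hab : a ≠ b) {u v : V}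
    (h : collapse hab u = collapse hab v) : u = v ∨ u = a ∧ v = b ∨ u = b ∧ v = a := by
  unfold collapse at h
  split_ifs at h with h1 h2 h2
  · exact Or.inl (h1.trans h2.symm)
  · exact Or.inr (Or.inr ⟨h1, (congrArg Subtype.val h).symm⟩)
  · exact Or.inr (Or.inl ⟨congrArg Subtype.val h, h2⟩)
  · exact Or.inl (congrArg Subtype.val h)

theorem collapse_of_ne {V : Type*} {a b : V} (hab : a ≠ b) (v : {v : V // v ≠ b}) :
    collapse hab v = v := by
  simp [collapse, v.2]

theorem collapse_eq {V : Type*} {a b : V} (hab : a ≠ b) : collapse hab a = collapse hab b := by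
  simp [collapse, hab]

/-- The simple graph obtained by contracting the pair `a`, `b`. -/
def contract {V : Type*} (G : SimpleGraph V) {a b : V} (hab : a ≠ b) :
    SimpleGraph {v : V // v ≠ b} where
  Adj p r := p ≠ r ∧ ∃ u v, collapse hab u = p ∧ collapse hab v = r ∧ G.Adj u v
  symm := ⟨fun _ _ ⟨h, u, v, hu, hv, huv⟩ => ⟨h.symm, v, u, hv, hu, huv.symm⟩⟩
  loopless := ⟨fun _ h => h.1 rfl⟩

theorem Connected.contract {V : Type*} {G : SimpleGraph V} (hG : G.Connected) {a b : V}
    (hab : a ≠ b) : (G.contract hab).Connected := by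
  have key : ∀ u v, G.Reachable u v →
      (G.contract hab).Reachable (collapse hab u) (collapse hab v) := by
    rintro u v ⟨w⟩
    induction w with
    | nil => exact Reachable.refl _
    | @cons u s v hus w ih =>
      refine Reachable.trans ?_ ih
      by_cases h : collapse hab u = collapse hab s
      · rw [h]
      · exact Adj.reachable (G := G.contract hab) ⟨h, u, s, rfl, rfl, hus⟩
  refine { preconnected := fun p r => ?_, nonempty := ⟨⟨a, hab⟩⟩ }
  have := key p r (hG p r)
  rwa [collapse_of_ne, collapse_of_ne] at this

/-- Two edges other than `ab` can merge only if they join a common vertex to `a` and to `b`. As `ab`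
lies in no triangle, only `ab` itself is lost. -/
theorem card_edgeSet_le_contract {V : Type*} [Finite V] {G : SimpleGraph V} {a b : V}
    (hab : G.Adj a b) (hno : ∀ x, G.Adj x a → ¬ G.Adj x b) :
    Nat.card G.edgeSet ≤ Nat.card (G.contract hab.ne).edgeSet + 1 := by
  have hne := hab.ne
  have h1 : (G.edgeSet \ {s(a, b)}).ncard ≤ (G.contract hne).edgeSet.ncard := by
    refine Set.ncard_le_ncard_of_injOn (Sym2.map (collapse hne)) ?_ ?_ (Set.toFinite _)
    · intro e
      induction e using Sym2.ind with
      | _ u v =>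
        rintro ⟨huv, hne'⟩
        refine ⟨fun h => ?_, u, v, rfl, rfl, huv⟩
        rcases collapse_eq_collapse hne h with rfl | ⟨rfl, rfl⟩ | ⟨rfl, rfl⟩
        · exact G.irrefl huv
        · exact hne' rfl
        · exact hne' Sym2.eq_swap
    · have key : ∀ u v u' v', G.Adj u v → G.Adj u' v' → s(u, v) ≠ s(a, b) →
          s(u', v') ≠ s(a, b) → collapse hne u = collapse hne u' →
          collapse hne v = collapse hne v' → s(u, v) = s(u', v') := by
        intro u v u' v' huv huv' hn hn' h1 h2
        rcases collapse_eq_collapse hne h1 with rfl | ⟨rfl, rfl⟩ | ⟨rfl, rfl⟩ <;>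
        rcases collapse_eq_collapse hne h2 with rfl | ⟨rfl, rfl⟩ | ⟨rfl, rfl⟩
        · rfl
        · exact absurd huv' (hno _ huv)
        · exact absurd huv (hno _ huv')
        · exact absurd huv'.symm (hno _ huv.symm)
        · exact absurd huv G.irrefl
        · exact absurd rfl hn
        · exact absurd huv.symm (hno _ huv'.symm)
        · exact absurd Sym2.eq_swap hn
        · exact absurd huv G.irrefl
      intro e he e' he' hee
      induction e using Sym2.ind with
      | _ u v =>
        induction e' using Sym2.ind with
        | _ u' v' =>
          simp only [Sym2.map_mk, Sym2.eq_iff] at hee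
          rcases hee with ⟨h1, h2⟩ | ⟨h1, h2⟩
          · exact key u v u' v' he.1 he'.1 he.2 he'.2 h1 h2
          · rw [Sym2.eq_swap (a := u')]
            refine key u v v' u' he.1 he'.1.symm he.2 ?_ h1 h2
            rw [Sym2.eq_swap]
            exact he'.2
  have h2 := Set.ncard_sdiff_singleton_add_one (s := G.edgeSet) (a := s(a, b)) hab (Set.toFinite _)
  change G.edgeSet.ncard ≤ (G.contract hne).edgeSet.ncard + 1
  omega

theorem RainbowOn.of_contract_univ {V : Type*} [Fintype V] {G : SimpleGraph V} {a b : V}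
    [Fintype {v : V // v ≠ b}] (hab : G.Adj a b) {q : ℕ}
    (h : (G.contract hab.ne).RainbowOn Finset.univ q) : G.RainbowOn Finset.univ (q + 1) := by
  refine h.of_contract (collapse hab.ne) hab (Finset.mem_univ _) (Finset.mem_univ _)
    (collapse_eq _) ?_ (fun _ _ => Finset.mem_univ _) ?_
  · intro u _ v _ huv
    rcases collapse_eq_collapse _ huv with rfl | ⟨rfl, rfl⟩ | ⟨rfl, rfl⟩
    · exact Or.inl rfl
    · exact Or.inr rfl
    · exact Or.inr Sym2.eq_swap
  · rintro p _ r _ ⟨_, u, v, h1, h2, h3⟩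
    exact ⟨u, Finset.mem_univ _, v, Finset.mem_univ _, h1, h2, h3⟩


/-! ### Finite checks: pattern search, growth and coloring certificates -/

noncomputable section

/-! Bounded quantifiers and list access, by recursors so that the kernel evaluates them fast. -/

/-- Applies `f` to the value of `n`; this makes the kernel evaluate `n` once. -/
def force {α : Type} (n : ℕ) (f : ℕ → α) : α :=
  Nat.rec (f 0) (fun m _ => f (Nat.succ m)) n

def allBelow (n : ℕ) (f : ℕ → Bool) : Bool :=
  Nat.rec true (fun m ih => cond (f m) ih false) n

def allOf {α : Type} (l : List α) (f : α → Bool) : Bool :=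
  List.rec true (fun a _ ih => cond (f a) ih false) l

def anyOf {α : Type} (l : List α) (f : α → Bool) : Bool :=
  List.rec false (fun a _ ih => cond (f a) true ih) l

def entry {α : Type} (l : List (List α)) : ℕ → List α :=
  List.rec (fun _ => []) (fun a _ ih i => Nat.rec a (fun m _ => ih m) i) l

theorem allBelow_eq_true {n : ℕ} {f : ℕ → Bool} : allBelow n f = true ↔ ∀ m < n, f m = true := by
  induction n with
  | zero => simp [allBelow]
  | succ n ih =>
    have : allBelow (n + 1) f = cond (f n) (allBelow n f) false := rfl
    rw [this, Nat.forall_lt_succ_right, ← ih]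
    cases f n <;> simp

theorem allOf_eq_true {α : Type} {l : List α} {f : α → Bool} :
    allOf l f = true ↔ ∀ a ∈ l, f a = true := by
  induction l with
  | nil => simp [allOf]
  | cons a l ih =>
    have : allOf (a :: l) f = cond (f a) (allOf l f) false := rfl
    rw [this, List.forall_mem_cons, ← ih]
    cases f a <;> simp

theorem anyOf_eq_true {α : Type} {l : List α} {f : α → Bool} :
    anyOf l f = true ↔ ∃ a ∈ l, f a = true := by
  induction l with
  | nil => simp [anyOf]
  | cons a l ih =>
    have : anyOf (a :: l) f = cond (f a) true (anyOf l f) := rfl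
    rw [this, List.exists_mem_cons_iff, ← ih]
    cases f a <;> simp

theorem entry_eq_getD {α : Type} (l : List (List α)) (i : ℕ) : entry l i = l.getD i [] := by
  induction l generalizing i with
  | nil => rfl
  | cons a l ih =>
    cases i with
    | zero => rfl
    | succ i => exact ih i

/-- A finite graph on `0, …, k - 1`: the `i`-th entry lists the neighbors of `i` among the smaller
vertices. -/
abbrev Pattern := List (List ℕ)

/-- A pattern whose edges carry colors. -/
abbrev ColoredPattern := List (List (ℕ × ℕ))

namespace Pattern

/-- The adjacency matrix, in rows of 16 bits, of the graph with the single edge `ij`. -/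
def edgeCode (i j : ℕ) : ℕ :=
  Nat.lor (Nat.shiftLeft 1 (Nat.add (Nat.mul 16 i) j)) (Nat.shiftLeft 1 (Nat.add (Nat.mul 16 j) i))

def adjCode (m i j : ℕ) : Bool :=
  Nat.beq (Nat.land (Nat.shiftRight m (Nat.add (Nat.mul 16 i) j)) 1) 1

/-- The adjacency matrix of a pattern. -/
def code (P : Pattern) : ℕ :=
  Nat.rec 0 (fun i ih => List.rec ih (fun j _ ih => Nat.lor ih (edgeCode i j)) (entry P i)) P.length

/-- Searches an embedding into the graph on `0, …, k - 1` with adjacency matrix `m`. The images of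
the first vertices are encoded in `placed`, with 4 bits for each; the bits of `free` mark the
unused vertices. The result is `0` if there is none. -/
def search (m k : ℕ) (P : Pattern) : (pos placed free : ℕ) → ℕ :=
  List.rec (fun _ placed _ => Nat.succ placed)
    (fun nb _ next pos placed free => force
      (List.rec free (fun j _ c => Nat.land c (Nat.shiftRight m (Nat.mul 16
        (Nat.land (Nat.shiftRight placed (Nat.mul 4 j)) 15)))) nb)
      fun c => Nat.rec 0 (fun v ih =>
        cond (Nat.beq (Nat.land (Nat.shiftRight c v) 1) 1)
          (Nat.rec ih (fun r _ => Nat.succ r)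
            (force (Nat.xor free (Nat.shiftLeft 1 v)) fun free' =>
              force (Nat.lor placed (Nat.shiftLeft v pos)) fun placed' =>
                next (Nat.add pos 4) placed' free'))
          ih) k) P

/-- Verifies a candidate map directly, so that `search` needs no correctness proof. -/
def embeds (k m : ℕ) (P : Pattern) (y : ℕ → ℕ) : Bool :=
  allBelow P.length fun i => force (y i) fun v => Nat.blt v k &&
    (allBelow i fun j => !Nat.beq (y j) v) &&
    allOf (entry P i) fun j => Nat.blt j P.length && adjCode m (y j) v

/-- The graph on `0, …, k - 1` with adjacency matrix `m` contains a copy of `P`. -/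
def contained (k m : ℕ) (P : Pattern) : Bool :=
  Nat.ble P.length k &&
    force (Nat.pred (search m k P 0 0 (Nat.pred (Nat.shiftLeft 1 k)))) fun r =>
      embeds k m P fun i => Nat.land (Nat.shiftRight r (Nat.mul 4 i)) 15

def anyContained (prev : List Pattern) (k m : ℕ) : Bool :=
  force m fun m => anyOf prev (contained k m)

def numEdges (P : Pattern) : ℕ :=
  (P.map List.length).sum

/-- Every way to enlarge `P` inside a graph on at least seven vertices, with at least ten edges all
of which lie in triangles, produces a graph that contains one of `prev`. -/
def closed (prev : List Pattern) (P : Pattern) : Bool :=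
  Nat.blt 0 P.length && Nat.blt P.length 15 && (Nat.blt P.length 7 || Nat.blt P.numEdges 10) &&
  force P.code fun m => force P.length fun k => allBelow k fun j =>
    anyContained prev (k + 2) (m ||| edgeCode j k ||| edgeCode j (k + 1) ||| edgeCode k (k + 1)) &&
    allBelow j fun i =>
      anyContained prev (k + 1) (m ||| edgeCode i j ||| edgeCode i k ||| edgeCode j k) &&
      (Nat.blt k 7 || adjCode m i j || anyContained prev k (m ||| edgeCode i j))

def allClosed : List Pattern → List Pattern → Bool
  | _, [] => true
  | prev, P :: rest => P.closed prev && allClosed (prev ++ [P]) rest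

/-- Every graph on six vertices obtained from the one with adjacency matrix `m` by adding edges of
`todo`, leaving out at most `5 - absent` of them, contains one of `prev`. -/
def forced (prev : List Pattern) : List (ℕ × ℕ) → (m absent : ℕ) → Bool
  | [], _, _ => false
  | e :: rest, m, absent =>
    force (m ||| edgeCode e.1 e.2) (fun m' =>
      anyContained prev 6 m' || forced prev rest m' absent) &&
    (Nat.ble 5 absent || forced prev rest m (absent + 1))

end Pattern

namespace ColoredPattern

def uncolor (P : ColoredPattern) : Pattern :=
  P.map (List.map Prod.fst)

/-- The edges `(j, i, c)`, where `j < i` are the ends and `c` is the color. -/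
def edges (P : ColoredPattern) : List (ℕ × ℕ × ℕ) :=
  (List.range P.length).flatMap fun i => (P.getD i []).map fun e => (e.1, i, e.2)

/-- The sets of edges that use every color less than `q` exactly once. -/
def transversals (E : List (ℕ × ℕ × ℕ)) : ℕ → List (List (ℕ × ℕ × ℕ))
  | 0 => [[]]
  | q + 1 => (transversals E q).flatMap fun t =>
      (E.filter fun e => Nat.beq e.2.2 q).map fun e => e :: t

/-- Labels of `0, …, k - 1` by the components of the graph with the given edges. -/
def labels (k : ℕ) (t : List (ℕ × ℕ × ℕ)) : List ℕ :=
  t.foldr (fun e L => L.map fun l =>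
    if Nat.beq l (L.getD e.1 0) then L.getD e.2.1 0 else l) (List.range k)

def consistent (E : List (ℕ × ℕ × ℕ)) : Bool :=
  E.all fun e => Nat.blt e.1 e.2.1 && E.all fun f =>
    !(Nat.beq e.1 f.1 && Nat.beq e.2.1 f.2.1) || Nat.beq e.2.2 f.2.2

def covers (k : ℕ) (Ls : List (List ℕ)) : Bool :=
  (List.range k).all fun a => (List.range k).all fun b => (List.range k).all fun d =>
    Ls.any fun L => Nat.beq (L.getD a 0) (L.getD b 0) && Nat.beq (L.getD a 0) (L.getD d 0)

/-- The coloring of `P` is a rainbow coloring with `q` colors. -/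
def certifies (q : ℕ) (P : ColoredPattern) : Bool :=
  consistent P.edges && covers P.length ((transversals P.edges q).map (labels P.length))

end ColoredPattern

/-- Rainbow colored graphs with three colors fewer than vertices. -/
def savingPatterns : List ColoredPattern :=
  [[[], [(0, 0)], [(1, 1)], [(0, 1), (2, 2)], [(2, 0)], [(0, 2), (4, 1)]],
   [[], [(0, 1)], [(1, 0)], [(0, 0), (2, 1)], [(1, 2)], [(0, 2), (4, 1)]],
   [[], [(0, 2)], [(0, 0), (1, 2)], [(0, 1), (1, 0)], [(0, 0), (2, 0), (3, 2)], [(1, 1)]],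
   [[], [(0, 1)], [(0, 0), (1, 2)], [(0, 0), (2, 1)], [(1, 3)], [(1, 3), (4, 0)], [(0, 2)]],
   [[], [(0, 2)], [(0, 3), (1, 0)], [(0, 2)], [(0, 3), (3, 1)], [(0, 0)], [(0, 1)]],
   [[], [(0, 0)], [(0, 1)], [(1, 1), (2, 0)], [(0, 2)], [(0, 3)], [(4, 3), (5, 2)]],
   [[], [(0, 3)], [(0, 1), (1, 4)], [(0, 0)], [(0, 0)], [(3, 1), (4, 2)], [(1, 4)],
     [(1, 4), (6, 2)]],
   [[], [(0, 0)], [(1, 1)], [(0, 0), (2, 2)], [(0, 3)], [(0, 4), (4, 1)], [(2, 3)],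
     [(2, 4), (6, 2)]],
   [[], [(0, 1)], [(0, 3), (1, 2)], [(0, 0)], [(1, 0)], [(3, 1), (4, 3)], [(0, 2)]],
   [[], [(0, 0)], [(0, 2)], [(1, 4)], [(1, 5), (3, 1)], [(2, 4)], [(2, 5), (5, 3)], [(0, 1)],
     [(0, 3)]],
   [[], [(0, 0)], [(1, 1)], [(0, 0), (2, 2)], [(0, 1), (2, 0)], [(0, 2), (2, 0)]]]

/-- Graphs that do not contain a saving pattern, but are forced to grow into one. -/
def growingPatterns : List Pattern :=
  [[[], [0], [0, 1], [0, 1], [0, 2], [1, 2]],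
   [[], [0], [0, 1], [0, 1, 2], [0, 1]],
   [[], [0], [0, 1], [0, 1], [0, 1]],
   [[], [0], [0, 1], [0, 1], [0, 2]],
   [[], [0], [0, 1], [0, 1], [0], [0, 4]],
   [[], [0], [0, 1], [1, 2], [0], [0, 4]],
   [[], [0], [0, 1], [0], [0, 3], [1], [1, 5]],
   [[], [0], [0, 1], [0, 1]],
   [[], [0], [0, 1], [0], [0, 3]],
   [[], [0], [0, 1]]]

theorem savingPatterns_certified :
    (allOf savingPatterns fun P => Nat.ble 3 P.length && P.certifies (P.length - 3)) = true := by
  decide +kernel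

/-- The order of the list matters: a pattern may grow into saving patterns or into those listed
before it, and the triangle comes last. -/
theorem growingPatterns_closed :
    Pattern.allClosed (savingPatterns.map ColoredPattern.uncolor) growingPatterns = true := by
  decide +kernel

/-- The spanning trees on six vertices with a vertex of degree at least four, each with an order in
which to examine the remaining pairs of vertices. -/
def sixVertexTrees : List (Pattern × List (ℕ × ℕ)) :=
  [([[], [0], [0], [0], [0], [0]],
    [(3, 5), (3, 4), (1, 4), (2, 3), (1, 2), (1, 5), (2, 4), (2, 5), (4, 5), (1, 3)]),
   ([[], [0], [0], [0], [0], [1]],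
    [(3, 5), (3, 4), (2, 4), (2, 5), (2, 3), (4, 5), (1, 2), (1, 4), (1, 3), (0, 5)])]

theorem sixVertexTrees_forced :
    (allOf sixVertexTrees fun T => Nat.beq T.1.length 6 &&
      Pattern.forced ((savingPatterns.take 3).map ColoredPattern.uncolor) T.2 T.1.code 0) = true := by
  decide +kernel

theorem sixVertexTrees_contained : (allBelow 5 fun i => anyOf sixVertexTrees fun T =>
    Pattern.contained 6 (Pattern.code [[], [0], [0], [0], [0], [i]]) T.1) = true := by
  decide +kernel

end
-- Soundness of the pattern search
namespace Pattern

/-- `x` maps the vertices of `P` injectively to vertices of `G`, and edges to edges. -/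
def IsEmbedding {V : Type*} (P : Pattern) (G : SimpleGraph V) (x : ℕ → V) : Prop :=
  Set.InjOn x (Set.Iio P.length) ∧
    ∀ i < P.length, ∀ j ∈ entry P i, j < P.length ∧ G.Adj (x j) (x i)

/-- `x` maps the graph on `0, …, k - 1` with adjacency matrix `m` injectively to vertices of `G`,
and edges to edges. -/
def IsCode {V : Type*} (G : SimpleGraph V) (x : ℕ → V) (k m : ℕ) : Prop :=
  k ≤ 16 ∧ Set.InjOn x (Set.Iio k) ∧
    ∀ i < 16, ∀ j < 16, m.testBit (16 * i + j) = true → i < k ∧ j < k ∧ G.Adj (x i) (x j)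

theorem adjCode_eq (m i j : ℕ) : adjCode m i j = m.testBit (16 * i + j) := by
  have h : adjCode m i j = Nat.beq ((m >>> (16 * i + j)) &&& 1) 1 := rfl
  rw [h, Nat.testBit, Nat.and_comm, Nat.one_and_eq_mod_two]
  rcases Nat.mod_two_eq_zero_or_one (m >>> (16 * i + j)) with h | h <;> rw [h] <;> rfl

theorem testBit_edgeCode {i j n : ℕ} :
    (edgeCode i j).testBit n = true ↔ n = 16 * i + j ∨ n = 16 * j + i := by
  have h : edgeCode i j = 1 <<< (16 * i + j) ||| 1 <<< (16 * j + i) := rfl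
  rw [h, Nat.testBit_or, Nat.one_shiftLeft, Nat.one_shiftLeft, Nat.testBit_two_pow,
    Nat.testBit_two_pow, Bool.or_eq_true, decide_eq_true_eq, decide_eq_true_eq]
  exact or_congr eq_comm eq_comm

variable {V : Type*} {G : SimpleGraph V} {x : ℕ → V} {k m : ℕ}

theorem IsCode.addEdge (h : IsCode G x k m) {i j : ℕ} (hi : i < k) (hj : j < k)
    (hij : G.Adj (x i) (x j)) : IsCode G x k (m ||| edgeCode i j) := by
  obtain ⟨hk, hinj, hadj⟩ := h
  refine ⟨hk, hinj, fun a ha b hb hab => ?_⟩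
  rw [Nat.testBit_or, Bool.or_eq_true, testBit_edgeCode] at hab
  rcases hab with hab | hab | hab
  · exact hadj a ha b hb hab
  · obtain ⟨rfl, rfl⟩ : a = i ∧ b = j := by omega
    exact ⟨hi, hj, hij⟩
  · obtain ⟨rfl, rfl⟩ : a = j ∧ b = i := by omega
    exact ⟨hj, hi, hij.symm⟩

theorem IsCode.addVertex (h : IsCode G x k m) (hk : k + 1 ≤ 16) {y : V}
    (hy : ∀ i < k, x i ≠ y) : IsCode G (Function.update x k y) (k + 1) m := by
  obtain ⟨-, hinj, hadj⟩ := h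
  have hne : ∀ i < k, Function.update x k y i = x i := fun i hi =>
    Function.update_of_ne hi.ne _ _
  refine ⟨hk, ?_, fun a ha b hb hab => ?_⟩
  · intro i hi j hj hij
    rcases Nat.lt_succ_iff_lt_or_eq.1 hi with hi | rfl <;>
    rcases Nat.lt_succ_iff_lt_or_eq.1 hj with hj | rfl
    · rw [hne i hi, hne j hj] at hij
      exact hinj hi hj hij
    · rw [hne i hi, Function.update_self] at hij
      exact absurd hij (hy i hi)
    · rw [hne j hj, Function.update_self] at hij
      exact absurd hij.symm (hy j hj)
    · rfl
  · obtain ⟨h1, h2, h3⟩ := hadj a ha b hb hab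
    rw [hne a h1, hne b h2]
    exact ⟨by omega, by omega, h3⟩

/-- Only this direction is needed: a set bit must come from an edge of the pattern. -/
theorem testBit_code {P : Pattern} (hP : ∀ i < P.length, ∀ j ∈ entry P i, j < 16)
    (hlen : P.length ≤ 16) {a b : ℕ} (_ : a < 16) (hb : b < 16)
    (h : P.code.testBit (16 * a + b) = true) :
    (a < P.length ∧ b ∈ entry P a) ∨ (b < P.length ∧ a ∈ entry P b) := by
  -- These copy the two nested recursors of `code`, so that each can be treated by its own
  -- induction.
  let row : ℕ → ℕ → List ℕ → ℕ := fun i c l =>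
    List.rec c (fun j _ ih => Nat.lor ih (edgeCode i j)) l
  let upTo : ℕ → ℕ := fun n => Nat.rec 0 (fun i ih => row i ih (entry P i)) n
  have hrow : ∀ i < 16, ∀ c l, (∀ j ∈ l, j < 16) → (row i c l).testBit (16 * a + b) = true →
      c.testBit (16 * a + b) = true ∨ (a = i ∧ b ∈ l) ∨ (b = i ∧ a ∈ l) := by
    intro i hi c l hl
    induction l with
    | nil => exact Or.inl
    | cons j l ih =>
      intro h
      have h' : (row i c l ||| edgeCode i j).testBit (16 * a + b) = true := h
      rw [Nat.testBit_or, Bool.or_eq_true, testBit_edgeCode] at h'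
      have hj := hl j (by simp)
      rcases h' with h' | h' | h'
      · rcases ih (fun j hj => hl j (by simp [hj])) h' with h' | ⟨h1, h2⟩ | ⟨h1, h2⟩
        · exact Or.inl h'
        · exact Or.inr (Or.inl ⟨h1, by simp [h2]⟩)
        · exact Or.inr (Or.inr ⟨h1, by simp [h2]⟩)
      · obtain ⟨rfl, rfl⟩ : a = i ∧ b = j := by omega
        simp
      · obtain ⟨rfl, rfl⟩ : a = j ∧ b = i := by omega
        simp
  have hupTo : ∀ n ≤ P.length, (upTo n).testBit (16 * a + b) = true →
      (a < P.length ∧ b ∈ entry P a) ∨ (b < P.length ∧ a ∈ entry P b) := by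
    intro n
    induction n with
    | zero => intro _ h; simp [upTo] at h
    | succ n ih =>
      intro hn h
      rcases hrow n (by omega) (upTo n) (entry P n) (hP n (by omega)) h with
        h | ⟨rfl, h⟩ | ⟨rfl, h⟩
      · exact ih (by omega) h
      · exact Or.inl ⟨by omega, h⟩
      · exact Or.inr ⟨by omega, h⟩
  exact hupTo P.length le_rfl h

theorem IsEmbedding.isCode {P : Pattern} (h : P.IsEmbedding G x) (hlen : P.length ≤ 16) :
    IsCode G x P.length P.code := by
  refine ⟨hlen, h.1, fun a ha b hb hab => ?_⟩
  rcases testBit_code (fun i hi j hj => (h.2 i hi j hj).1.trans_le hlen) hlen ha hb hab with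
    ⟨h1, h2⟩ | ⟨h1, h2⟩
  · exact ⟨h1, (h.2 a h1 b h2).1, (h.2 a h1 b h2).2.symm⟩
  · exact ⟨(h.2 b h1 a h2).1, h1, (h.2 b h1 a h2).2⟩

theorem force_eq {α : Type} (n : ℕ) (f : ℕ → α) : force n f = f n := by
  cases n <;> rfl

theorem IsCode.exists_isEmbedding (h : IsCode G x k m) {P : Pattern}
    (hP : contained k m P = true) : ∃ y, P.IsEmbedding G y := by
  obtain ⟨hk, hinj, hadj⟩ := h
  simp only [contained, force_eq, Bool.and_eq_true] at hP
  obtain ⟨-, hP⟩ := hP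
  -- The result of the search is forgotten; only the verification by `embeds` is used.
  generalize (fun i => Nat.land (Nat.shiftRight _ (Nat.mul 4 i)) 15) = y at hP
  have hbeq : ∀ a b, Nat.beq a b = false ↔ a ≠ b := fun a b => by
    rw [← Bool.not_eq_true, Nat.beq_eq]
  simp only [embeds, allBelow_eq_true, force_eq, Bool.and_eq_true, allOf_eq_true, Nat.blt_eq,
    adjCode_eq, Bool.not_eq_true', hbeq] at hP
  refine ⟨x ∘ y, ?_, fun i hi j hj => ?_⟩
  · intro i hi j hj hij
    have hy := hinj (hP i hi).1.1 (hP j hj).1.1 hij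
    rcases lt_trichotomy i j with hlt | rfl | hlt
    · exact absurd hy ((hP j hj).1.2 i hlt)
    · rfl
    · exact absurd hy.symm ((hP i hi).1.2 j hlt)
  · obtain ⟨hjl, h1⟩ := (hP i hi).2 j hj
    exact ⟨hjl, (hadj _ ((hP j hjl).1.1.trans_le hk) _ ((hP i hi).1.1.trans_le hk) h1).2.2⟩

theorem IsCode.of_anyContained (h : IsCode G x k m) {prev : List Pattern} {R : Prop}
    (hprev : ∀ P ∈ prev, ∀ y, P.IsEmbedding G y → R) (hm : anyContained prev k m = true) : R := by
  simp only [anyContained, force_eq, anyOf_eq_true] at hm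
  obtain ⟨P, hP, hc⟩ := hm
  obtain ⟨y, hy⟩ := h.exists_isEmbedding hc
  exact hprev P hP y hy

end Pattern
-- Soundness of the coloring certificates
namespace ColoredPattern

theorem entry_uncolor (P : ColoredPattern) (i : ℕ) :
    entry P.uncolor i = (P.getD i []).map Prod.fst := by
  rw [entry_eq_getD]
  exact List.getD_map (l := P) (n := i) (d := []) (f := List.map Prod.fst)

theorem mem_edges {P : ColoredPattern} {e : ℕ × ℕ × ℕ} (he : e ∈ P.edges) :
    e.2.1 < P.length ∧ e.1 ∈ entry P.uncolor e.2.1 := by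
  simp only [edges, List.mem_flatMap, List.mem_range, List.mem_map] at he
  obtain ⟨i, hi, f, hf, rfl⟩ := he
  refine ⟨hi, ?_⟩
  rw [entry_uncolor]
  exact List.mem_map_of_mem hf

theorem mem_transversals {E : List (ℕ × ℕ × ℕ)} {q : ℕ} {t : List (ℕ × ℕ × ℕ)}
    (ht : t ∈ transversals E q) :
    (∀ e ∈ t, e ∈ E ∧ e.2.2 < q) ∧ ∀ e ∈ t, ∀ f ∈ t, e.2.2 = f.2.2 → e = f := by
  induction q generalizing t with
  | zero =>
    obtain rfl : t = [] := by simpa [transversals] using ht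
    simp
  | succ q ih =>
    simp only [transversals, List.mem_flatMap, List.mem_map, List.mem_filter, Nat.beq_eq] at ht
    obtain ⟨t, ht, e, ⟨heE, heq⟩, rfl⟩ := ht
    obtain ⟨h1, h2⟩ := ih ht
    refine ⟨?_, ?_⟩
    · intro f hf
      rcases List.mem_cons.1 hf with rfl | hf
      · exact ⟨heE, by omega⟩
      · exact ⟨(h1 f hf).1, by have := (h1 f hf).2; omega⟩
    · intro f hf g hg hfg
      rcases List.mem_cons.1 hf with rfl | hf' <;> rcases List.mem_cons.1 hg with rfl | hg'
      · rfl
      · have := (h1 g hg').2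
        omega
      · have := (h1 f hf').2
        omega
      · exact h2 f hf' g hg' hfg

theorem length_labels (k : ℕ) (t : List (ℕ × ℕ × ℕ)) : (labels k t).length = k := by
  induction t with
  | nil => simp [labels]
  | cons e t ih => simpa [labels] using ih

variable {V : Type*} {G : SimpleGraph V} {x : ℕ → V}

/-- Adding an edge merges the label classes of its ends, so equal labels always reflect a path. -/
theorem reachable_of_labels_eq {k : ℕ} {t : List (ℕ × ℕ × ℕ)} {H : SimpleGraph V}
    (ht : ∀ e ∈ t, e.1 < k ∧ e.2.1 < k ∧ H.Adj (x e.1) (x e.2.1)) {a b : ℕ} (ha : a < k)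
    (hb : b < k) (hab : (labels k t).getD a 0 = (labels k t).getD b 0) :
    H.Reachable (x a) (x b) := by
  induction t generalizing a b with
  | nil =>
    obtain rfl : a = b := by simpa [labels, ha, hb] using hab
    exact Reachable.refl _
  | cons e t ih =>
    have ih' : ∀ {a b : ℕ}, a < k → b < k →
        (labels k t).getD a 0 = (labels k t).getD b 0 → H.Reachable (x a) (x b) :=
      ih fun f hf => ht f (List.mem_cons_of_mem _ hf)
    obtain ⟨h1, h2, h3⟩ := ht e List.mem_cons_self
    have hget : ∀ a < k, (labels k (e :: t)).getD a 0 =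
        if (labels k t).getD a 0 = (labels k t).getD e.1 0 then (labels k t).getD e.2.1 0
        else (labels k t).getD a 0 := by
      intro a ha
      have hL : labels k (e :: t) = (labels k t).map fun l =>
        if Nat.beq l ((labels k t).getD e.1 0) then (labels k t).getD e.2.1 0 else l := rfl
      have hlen := length_labels k t
      generalize labels k t = L at hL hlen
      rw [hL]
      simp [List.getD_eq_getElem?_getD, hlen, ha]
    rw [hget a ha, hget b hb] at hab
    split_ifs at hab with h4 h5 h5
    · exact ih' ha hb (h4.trans h5.symm)
    · exact (ih' ha h1 h4).trans (h3.reachable.trans (ih' h2 hb hab))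
    · exact (ih' ha h2 hab).trans (h3.symm.reachable.trans (ih' h1 hb h5.symm))
    · exact ih' ha hb hab

/-- A transversal has one edge of each color, so it is rainbow; `covers` says that each triple lies
in one component of some transversal. -/
theorem rainbowOn [DecidableEq V] {P : ColoredPattern} {q : ℕ} (hP : P.certifies q = true)
    (hx : P.uncolor.IsEmbedding G x) : G.RainbowOn ((Finset.range P.length).image x) q := by
  have hlen : P.uncolor.length = P.length := by simp [uncolor]
  obtain ⟨hinj, hadj⟩ := hx
  rw [hlen] at hinj hadj
  simp only [certifies, Bool.and_eq_true] at hP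
  obtain ⟨hcons, hcov⟩ := hP
  simp only [consistent, List.all_eq_true, Bool.and_eq_true, Bool.or_eq_true, Nat.blt_eq,
    Bool.not_eq_true', Nat.beq_eq] at hcons
  have hE : ∀ e ∈ P.edges, e.1 < P.length ∧ e.2.1 < P.length ∧ G.Adj (x e.1) (x e.2.1) := by
    intro e he
    obtain ⟨h1, h2⟩ := mem_edges he
    exact ⟨(hadj _ h1 _ h2).1, h1, (hadj _ h1 _ h2).2⟩
  have hcol : ∀ e ∈ P.edges, ∀ f ∈ P.edges, s(x e.1, x e.2.1) = s(x f.1, x f.2.1) →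
      e.2.2 = f.2.2 := by
    intro e he f hf hef
    obtain ⟨e1, e2, -⟩ := hE e he
    obtain ⟨f1, f2, -⟩ := hE f hf
    have e3 := (hcons e he).1
    have f3 := (hcons f hf).1
    rcases Sym2.eq_iff.1 hef with ⟨h1, h2⟩ | ⟨h1, h2⟩
    · have h1 := hinj e1 f1 h1
      have h2 := hinj e2 f2 h2
      rcases (hcons e he).2 f hf with h | h
      · simp [h1, h2] at h
      · exact h
    · have h1 := hinj e1 f2 h1
      have h2 := hinj e2 f1 h2
      omega
  -- The pattern's colors are carried to `G`, consistently by `hcol`; the value 0 elsewhere is never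
  -- used.
  have hc : ∃ c : Sym2 V → ℕ, ∀ e ∈ P.edges, c s(x e.1, x e.2.1) = e.2.2 := by
    classical
    refine ⟨fun s => if h : ∃ e ∈ P.edges, s = s(x e.1, x e.2.1) then h.choose.2.2 else 0,
      fun e he => ?_⟩
    have h : ∃ f ∈ P.edges, s(x e.1, x e.2.1) = s(x f.1, x f.2.1) := ⟨e, he, rfl⟩
    simp only [dif_pos h]
    exact (hcol e he _ h.choose_spec.1 h.choose_spec.2).symm
  obtain ⟨c, hc⟩ := hc
  refine ⟨c, ?_⟩
  simp only [Finset.mem_image, Finset.mem_range]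
  rintro _ ⟨a, ha, rfl⟩ _ ⟨b, hb, rfl⟩ _ ⟨d, hd, rfl⟩
  simp only [covers, List.all_eq_true, List.mem_range, List.any_eq_true, List.mem_map,
    Bool.and_eq_true, Nat.beq_eq] at hcov
  obtain ⟨L, ⟨t, ht, rfl⟩, hab, had⟩ := hcov a ha b hb d hd
  obtain ⟨ht1, ht2⟩ := mem_transversals ht
  set S : Set (Sym2 V) := {s | ∃ e ∈ t, s = s(x e.1, x e.2.1)} with hS
  have hSG : S ⊆ G.edgeSet := by
    rintro _ ⟨e, he, rfl⟩
    exact (hE e (ht1 e he).1).2.2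
  have hedge : (fromEdgeSet S).edgeSet = S := by
    rw [edgeSet_fromEdgeSet]
    ext e
    exact ⟨fun h => h.1, fun h => ⟨h, fun h' => G.not_isDiag_of_mem_edgeSet (hSG h) h'⟩⟩
  have hH : ∀ e ∈ t, e.1 < P.length ∧ e.2.1 < P.length ∧
      (fromEdgeSet S).Adj (x e.1) (x e.2.1) := by
    intro e he
    obtain ⟨h1, h2, -⟩ := hE e (ht1 e he).1
    refine ⟨h1, h2, ?_⟩
    rw [← mem_edgeSet, hedge]
    exact ⟨e, he, rfl⟩
  refine ⟨fromEdgeSet S, ?_, ?_, ?_, ?_, reachable_of_labels_eq hH ha hb hab,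
    reachable_of_labels_eq hH ha hd had⟩
  · intro u v huv
    rw [← mem_edgeSet, hedge] at huv
    exact hSG huv
  · intro u v huv
    rw [← mem_edgeSet, hedge] at huv
    obtain ⟨e, he, h⟩ := huv
    obtain ⟨h1, h2, -⟩ := hH e he
    rcases Sym2.eq_iff.1 h with ⟨rfl, -⟩ | ⟨rfl, -⟩
    · exact ⟨_, h1, rfl⟩
    · exact ⟨_, h2, rfl⟩
  · rw [hedge]
    rintro _ ⟨e, he, rfl⟩
    rw [hc e (ht1 e he).1]
    exact (ht1 e he).2
  · rw [hedge]
    rintro _ ⟨e, he, rfl⟩ _ ⟨f, hf, rfl⟩ hef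
    rw [hc e (ht1 e he).1, hc f (ht1 f hf).1] at hef
    rw [ht2 e he f hf hef]

end ColoredPattern

theorem rainbowOn_of_savingPattern {V : Type*} [Fintype V] {G : SimpleGraph V}
    (hG : G.Connected) {P : Pattern} (hP : P ∈ savingPatterns.map ColoredPattern.uncolor)
    {x : ℕ → V} (hx : P.IsEmbedding G x) : G.RainbowOn Finset.univ (Fintype.card V - 3) := by
  classical
  obtain ⟨C, hC, rfl⟩ := List.mem_map.1 hP
  have h := allOf_eq_true.1 savingPatterns_certified C hC
  rw [Bool.and_eq_true, Nat.ble_eq] at h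
  have hcard : ((Finset.range C.length).image x).card = C.length := by
    rw [Finset.card_image_of_injOn, Finset.card_range]
    simpa [ColoredPattern.uncolor, Set.InjOn] using hx.1
  have hle := Finset.card_le_univ ((Finset.range C.length).image x)
  have := (ColoredPattern.rainbowOn h.2 hx).univ hG (Finset.card_pos.1 (by omega))
  convert this using 1
  omega

/-! ### Growing patterns when every edge lies in a triangle -/

namespace Pattern

variable {V : Type*} {G : SimpleGraph V} {x : ℕ → V}

theorem numEdges_eq_sum (P : Pattern) :
    P.numEdges = ∑ i ∈ Finset.range P.length, (entry P i).length := by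
  induction P with
  | nil => rfl
  | cons a P ih =>
    rw [List.length_cons, Finset.sum_range_succ']
    change a.length + numEdges P = _
    rw [ih, add_comm]
    rfl

theorem exists_edge_not_mem_entry [Finite V] {P : Pattern}
    (hsurj : x '' Set.Iio P.length = Set.univ) (hlt : P.numEdges < Nat.card G.edgeSet) :
    ∃ j < P.length, ∃ i < j, G.Adj (x i) (x j) ∧ i ∉ entry P j ∧ j ∉ entry P i := by
  classical
  have := Fintype.ofFinite V
  let F : Finset (Sym2 V) := (Finset.range P.length).biUnion fun i =>
    ((entry P i).map fun j => s(x j, x i)).toFinset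
  have hF : F.card ≤ P.numEdges := by
    refine Finset.card_biUnion_le.trans ?_
    rw [numEdges_eq_sum]
    refine Finset.sum_le_sum fun i _ => ?_
    exact (List.toFinset_card_le _).trans_eq (List.length_map _)
  obtain ⟨e, heG, heF⟩ : ∃ e ∈ G.edgeFinset, e ∉ F := by
    by_contra! h
    have h1 := Finset.card_le_card h
    rw [edgeFinset_card, ← Nat.card_eq_fintype_card] at h1
    omega
  rw [mem_edgeFinset] at heG
  have hFmem : ∀ i < P.length, ∀ j ∈ entry P i, s(x j, x i) ∈ F := by
    intro i hi j hj
    simp only [F, Finset.mem_biUnion, Finset.mem_range, List.mem_toFinset, List.mem_map]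
    exact ⟨i, hi, j, hj, rfl⟩
  have key : ∀ i < P.length, ∀ j < P.length, e = s(x i, x j) → i ∉ entry P j ∧ j ∉ entry P i := by
    rintro i hi j hj rfl
    refine ⟨fun h => heF (hFmem j hj i h), fun h => heF ?_⟩
    rw [Sym2.eq_swap]
    exact hFmem i hi j h
  induction e using Sym2.ind with
  | _ u v =>
    obtain ⟨a, ha, rfl⟩ : u ∈ x '' Set.Iio P.length := by rw [hsurj]; trivial
    obtain ⟨b, hb, rfl⟩ : v ∈ x '' Set.Iio P.length := by rw [hsurj]; trivial
    have hab : G.Adj (x a) (x b) := heG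
    rcases lt_trichotomy a b with h | rfl | h
    · exact ⟨b, hb, a, h, hab, key a ha b hb rfl⟩
    · exact absurd hab G.irrefl
    · exact ⟨a, ha, b, h, hab.symm, key b hb a ha Sym2.eq_swap⟩

/-- If the pattern misses a vertex, an edge leaves it, and the third vertex of a triangle on that
edge is either inside or outside: one or two new vertices. If it is spanning, it has fewer than ten
edges, so `G` has a further edge to add. `closed` covers all three cases. -/
theorem IsEmbedding.of_closed [Finite V] (hG : G.Connected) (h7 : 7 ≤ Nat.card V)
    (h10 : 10 ≤ Nat.card G.edgeSet) (htri : ∀ a b, G.Adj a b → ∃ z, G.Adj a z ∧ G.Adj b z)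
    {R : Prop} {prev : List Pattern} (hprev : ∀ P ∈ prev, ∀ y, P.IsEmbedding G y → R)
    {P : Pattern} (hP : P.closed prev = true) (hx : P.IsEmbedding G x) : R := by
  simp only [closed, force_eq, Bool.and_eq_true, Bool.or_eq_true, allBelow_eq_true, Nat.blt_eq]
    at hP
  obtain ⟨⟨⟨h0, h15⟩, hnum⟩, hP⟩ := hP
  have hcode := hx.isCode (by omega)
  by_cases hU : x '' Set.Iio P.length = Set.univ
  · have hk : P.length = Nat.card V := by
      rw [← Set.ncard_univ, ← hU, hx.1.ncard_image]
      simp [Set.ncard_eq_toFinset_card']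
    obtain ⟨j, hj, i, hij, hadj, hn1, hn2⟩ := exists_edge_not_mem_entry (G := G) hU (by omega)
    rcases ((hP j hj).2 i hij).2 with (h | h) | h
    · omega
    · rw [adjCode_eq] at h
      rcases testBit_code (fun i hi j hj => by have := (hx.2 i hi j hj).1; omega) (by omega)
        (by omega) (by omega) h with h | h
      · exact absurd h.2 hn2
      · exact absurd h.2 hn1
    · exact (hcode.addEdge (hij.trans hj) hj hadj).of_anyContained hprev h
  · obtain ⟨_, ⟨a, ha, rfl⟩, y, hy, hay⟩ := hG.exists_adj_not_mem (Set.Nonempty.image x ⟨0, h0⟩) hU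
    have ha : a < P.length := ha
    obtain ⟨z, haz, hyz⟩ := htri _ _ hay
    have hy' : ∀ i < P.length, x i ≠ y := fun i hi h => hy ⟨i, hi, h⟩
    have hcy := hcode.addVertex (by omega) hy'
    have hxk := Function.update_self P.length y x
    have hxi : ∀ i < P.length, Function.update x P.length y i = x i := fun i hi =>
      Function.update_of_ne hi.ne _ _
    generalize hx' : Function.update x P.length y = x' at hcy hxk hxi
    by_cases hz : z ∈ x '' Set.Iio P.length
    · obtain ⟨b, hb, rfl⟩ := hz
      have hb : b < P.length := hb
      obtain ⟨j, hj, i, hij, h1, h2, h3⟩ : ∃ j < P.length, ∃ i < j,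
          G.Adj (x i) (x j) ∧ G.Adj (x i) y ∧ G.Adj (x j) y := by
        rcases lt_trichotomy a b with h | rfl | h
        · exact ⟨b, hb, a, h, haz, hay, hyz.symm⟩
        · exact absurd haz G.irrefl
        · exact ⟨a, ha, b, h, haz.symm, hyz.symm, hay⟩
      have hi := hij.trans hj
      refine IsCode.of_anyContained (x := x') ?_ hprev ((hP j hj).2 i hij).1
      refine ((hcy.addEdge (i := i) (j := j) ?_ ?_ ?_).addEdge ?_ ?_ ?_).addEdge ?_ ?_ ?_
      all_goals first | omega | (simp only [hxk, hxi i hi, hxi j hj]; assumption)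
    · have hz' : ∀ i < P.length + 1, x' i ≠ z := by
        intro i hi h
        rcases Nat.lt_succ_iff_lt_or_eq.1 hi with hi | rfl
        · exact hz ⟨i, hi, (hxi i hi).symm.trans h⟩
        · exact hyz.ne (hxk.symm.trans h)
      have hcz := hcy.addVertex (by omega) hz'
      have h1 : Function.update x' (P.length + 1) z a = x a :=
        (Function.update_of_ne (by omega) _ _).trans (hxi a ha)
      have h2 : Function.update x' (P.length + 1) z P.length = y :=
        (Function.update_of_ne (by omega) _ _).trans hxk
      have h3 := Function.update_self (P.length + 1) z x'
      refine IsCode.of_anyContained (x := Function.update x' (P.length + 1) z) ?_ hprev (hP a ha).1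
      refine ((hcz.addEdge (i := a) (j := P.length) ?_ ?_ ?_).addEdge ?_ ?_ ?_).addEdge ?_ ?_ ?_
      all_goals first | omega | (simp only [h1, h2, h3]; assumption)

theorem IsEmbedding.of_allClosed [Finite V] (hG : G.Connected) (h7 : 7 ≤ Nat.card V)
    (h10 : 10 ≤ Nat.card G.edgeSet) (htri : ∀ a b, G.Adj a b → ∃ z, G.Adj a z ∧ G.Adj b z)
    {R : Prop} {rest prev : List Pattern} (hprev : ∀ P ∈ prev, ∀ y, P.IsEmbedding G y → R)
    (hrest : allClosed prev rest = true) : ∀ P ∈ rest, ∀ y, P.IsEmbedding G y → R := by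
  induction rest generalizing prev with
  | nil => simp
  | cons P rest ih =>
    rw [allClosed, Bool.and_eq_true] at hrest
    have hPR : ∀ y, P.IsEmbedding G y → R := fun y hy =>
      hy.of_closed hG h7 h10 htri hprev hrest.1
    intro Q hQ
    rcases List.mem_cons.1 hQ with rfl | hQ
    · exact hPR
    · refine ih (fun Q hQ => ?_) hrest.2 Q hQ
      rcases List.mem_append.1 hQ with hQ | hQ
      · exact hprev Q hQ
      · rw [List.mem_singleton.1 hQ]
        exact hPR

theorem isEmbedding_triangle {a b c : V} (hab : G.Adj a b) (hac : G.Adj a c) (hbc : G.Adj b c) :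
    IsEmbedding [[], [0], [0, 1]] G fun i => if i = 0 then a else if i = 1 then b else c := by
  refine ⟨?_, ?_⟩
  · intro i hi j hj hij
    have hi : i < 3 := hi
    have hj : j < 3 := hj
    have := hab.ne
    have := hac.ne
    have := hbc.ne
    interval_cases i <;> interval_cases j <;> simp_all
  · intro i hi j hj
    have hi : i < 3 := hi
    rw [entry_eq_getD] at hj
    interval_cases i
    · simp at hj
    · obtain rfl : j = 0 := by simpa using hj
      simpa using hab
    · rcases (by simpa using hj : j = 0 ∨ j = 1) with rfl | rfl
      · simpa using hac
      · simpa using hbc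

end Pattern

theorem Connected.rainbowOn_of_edges_in_triangles {V : Type*} [Fintype V] {G : SimpleGraph V}
    (hG : G.Connected) (h7 : 7 ≤ Fintype.card V) (h10 : 10 ≤ Nat.card G.edgeSet)
    (htri : ∀ a b, G.Adj a b → ∃ z, G.Adj a z ∧ G.Adj b z) :
    G.RainbowOn Finset.univ (Fintype.card V - 3) := by
  have : Nonempty G.edgeSet := (Nat.card_pos_iff.1 (by omega)).1
  obtain ⟨⟨e, he⟩⟩ := this
  induction e using Sym2.ind with
  | _ a b =>
    obtain ⟨c, hac, hbc⟩ := htri a b he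
    refine Pattern.IsEmbedding.of_allClosed hG (by rwa [Nat.card_eq_fintype_card]) h10 htri
      (fun P hP y hy => rainbowOn_of_savingPattern hG hP hy) growingPatterns_closed
      [[], [0], [0, 1]] ?_ _ (Pattern.isEmbedding_triangle he hac hbc)
    simp [growingPatterns]


/-! ### Graphs on six vertices -/

theorem card_edgeSet_add_card_le {V : Type*} [Fintype V] (G : SimpleGraph V) {A : Finset (Sym2 V)}
    (hA : ∀ e ∈ A, ¬ e.IsDiag ∧ e ∉ G.edgeSet) :
    Nat.card G.edgeSet + A.card ≤ (Fintype.card V).choose 2 := by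
  classical
  rw [← card_edgeFinset_top_eq_card_choose_two, Nat.card_eq_fintype_card, ← edgeFinset_card,
    ← Finset.card_union_of_disjoint]
  · refine Finset.card_le_card fun e he => ?_
    rw [mem_edgeFinset, edgeSet_top]
    rcases Finset.mem_union.1 he with he | he
    · exact G.not_isDiag_of_mem_edgeSet (mem_edgeFinset.1 he)
    · exact (hA e he).1
  · rw [Finset.disjoint_left]
    exact fun e he heA => (hA e heA).2 (mem_edgeFinset.1 he)

namespace Pattern

/-- `A` collects the non-edges found so far. Of the 15 pairs at least ten are edges, so a branch
with a sixth non-edge is impossible. -/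
theorem IsCode.of_forced {V : Type*} [Fintype V] {G : SimpleGraph V} (h6 : Fintype.card V = 6)
    (h10 : 10 ≤ Nat.card G.edgeSet) {R : Prop} {prev : List Pattern}
    (hprev : ∀ P ∈ prev, ∀ y, P.IsEmbedding G y → R) {x : ℕ → V} {todo : List (ℕ × ℕ)}
    (htodo : ∀ e ∈ todo, e.1 < 6 ∧ e.2 < 6 ∧ e.1 ≠ e.2)
    (hnodup : todo.Pairwise fun e f => s(e.1, e.2) ≠ s(f.1, f.2)) {m absent : ℕ}
    (hcode : IsCode G x 6 m) {A : Finset (Sym2 V)} (hA : ∀ e ∈ A, ¬ e.IsDiag ∧ e ∉ G.edgeSet)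
    (hAcard : A.card = absent) (hAtodo : ∀ e ∈ todo, s(x e.1, x e.2) ∉ A)
    (hf : forced prev todo m absent = true) : R := by
  classical
  induction todo generalizing m absent A with
  | nil => simp [forced] at hf
  | cons e rest ih =>
    simp only [forced, force_eq, Bool.and_eq_true, Bool.or_eq_true, Nat.ble_eq] at hf
    obtain ⟨h1, h2, h3⟩ := htodo e List.mem_cons_self
    rw [List.pairwise_cons] at hnodup
    have htodo' : ∀ e ∈ rest, e.1 < 6 ∧ e.2 < 6 ∧ e.1 ≠ e.2 := fun e he =>
      htodo e (List.mem_cons_of_mem _ he)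
    have hAtodo' : ∀ e ∈ rest, s(x e.1, x e.2) ∉ A := fun e he =>
      hAtodo e (List.mem_cons_of_mem _ he)
    by_cases hadj : G.Adj (x e.1) (x e.2)
    · have hcode' := hcode.addEdge h1 h2 hadj
      rcases hf.1 with hf | hf
      · exact hcode'.of_anyContained hprev hf
      · exact ih htodo' hnodup.2 hcode' hA hAcard hAtodo' hf
    · have hA' : ∀ f ∈ insert s(x e.1, x e.2) A, ¬ f.IsDiag ∧ f ∉ G.edgeSet := by
        intro f hf
        rcases Finset.mem_insert.1 hf with rfl | hf
        · exact ⟨fun h => h3 (hcode.2.1 h1 h2 (by simpa using h)), hadj⟩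
        · exact hA f hf
      have hcard := Finset.card_insert_of_notMem (hAtodo e List.mem_cons_self)
      have hle := card_edgeSet_add_card_le G hA'
      rw [h6, show Nat.choose 6 2 = 15 from rfl] at hle
      rcases hf.2 with hf | hf
      · omega
      · refine ih htodo' hnodup.2 hcode hA' (by omega) (fun f hf => ?_) hf
        rw [Finset.mem_insert, not_or]
        refine ⟨fun h => hnodup.1 f hf ?_, hAtodo' f hf⟩
        obtain ⟨f1, f2, -⟩ := htodo' f hf
        rcases Sym2.eq_iff.1 h with ⟨h4, h5⟩ | ⟨h4, h5⟩
        · rw [hcode.2.1 f1 h1 h4, hcode.2.1 f2 h2 h5]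
        · rw [hcode.2.1 f1 h2 h4, hcode.2.1 f2 h1 h5, Sym2.eq_swap]

end Pattern

/-- The degrees sum to at least 20, more than 6 · 3. -/
theorem exists_four_le_degree {V : Type*} [Fintype V] (G : SimpleGraph V) [DecidableRel G.Adj]
    (h6 : Fintype.card V = 6) (h10 : 10 ≤ Nat.card G.edgeSet) : ∃ v, 4 ≤ G.degree v := by
  classical
  by_contra! h
  have h1 := G.sum_degrees_eq_twice_card_edges
  have h2 : ∑ v, G.degree v ≤ ∑ _v : V, 3 := Finset.sum_le_sum fun v _ => by
    have := h v
    omega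
  rw [Finset.sum_const, Finset.card_univ, h6] at h2
  rw [edgeFinset_card, ← Nat.card_eq_fintype_card] at h1
  simp only [smul_eq_mul] at h2
  omega

theorem Connected.rainbowOn_of_card_eq_six {V : Type*} [Fintype V] {G : SimpleGraph V}
    (hG : G.Connected) (h6 : Fintype.card V = 6) (h10 : 10 ≤ Nat.card G.edgeSet) :
    G.RainbowOn Finset.univ (Fintype.card V - 3) := by
  classical
  obtain ⟨v, hv⟩ := G.exists_four_le_degree h6 h10
  obtain ⟨N, hN, hNcard⟩ := Finset.exists_subset_card_eq hv
  obtain ⟨a, b, c, d, hl⟩ := List.length_eq_four.1 ((Finset.length_toList N).trans hNcard)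
  have hadj : ∀ w ∈ [a, b, c, d], G.Adj v w := by
    rw [← hl]
    intro w hw
    simpa using hN (Finset.mem_toList.1 hw)
  have hnd : [v, a, b, c, d].Nodup := by
    rw [List.nodup_cons]
    exact ⟨fun h => G.irrefl (hadj v h), hl ▸ Finset.nodup_toList N⟩
  -- The sixth vertex hangs on the star formed by `v` and four neighbors, which gives a spanning
  -- tree.
  obtain ⟨u, hu, y, hy, huy⟩ := hG.exists_adj_not_mem (U := {w | w ∈ [v, a, b, c, d]})
    ⟨v, by simp⟩ (fun h => by
      have h1 : (Finset.univ : Finset V) ⊆ [v, a, b, c, d].toFinset := fun w _ => by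
        have : w ∈ {w | w ∈ [v, a, b, c, d]} := h ▸ Set.mem_univ w
        simpa using this
      have h2 := (Finset.card_le_card h1).trans (List.toFinset_card_le _)
      rw [Finset.card_univ, h6] at h2
      simp at h2)
  obtain ⟨i, hi, rfl⟩ := List.getElem_of_mem (show u ∈ [v, a, b, c, d] from hu)
  have hi : i < 5 := hi
  have hnd' : [v, a, b, c, d, y].Nodup := by
    have : [v, a, b, c, d, y] = [v, a, b, c, d] ++ [y] := rfl
    rw [this, List.nodup_append]
    exact ⟨hnd, by simp, fun w hw z hz h => hy (by
      rw [List.mem_singleton.1 hz] at h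
      exact h ▸ hw)⟩
  set x : ℕ → V := fun k => [v, a, b, c, d, y].getD k v with hx
  have hemb : Pattern.IsEmbedding [[], [0], [0], [0], [0], [i]] G x := by
    refine ⟨?_, ?_⟩
    · intro k hk l hl hkl
      have hk : k < 6 := hk
      have hl : l < 6 := hl
      simp only [hx, List.getD_eq_getElem?_getD] at hkl
      rw [List.getElem?_eq_getElem (by simpa using hk),
        List.getElem?_eq_getElem (by simpa using hl)] at hkl
      exact (hnd'.getElem_inj_iff).1 (by simpa using hkl)
    · intro k hk l hl
      have hk : k < 6 := hk
      rw [entry_eq_getD] at hl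
      have hxi : x i = [v, a, b, c, d][i] := by
        simp only [hx]
        interval_cases i <;> rfl
      interval_cases k
      · simp at hl
      · obtain rfl : l = 0 := by simpa using hl
        exact ⟨by simp, hadj a (by simp)⟩
      · obtain rfl : l = 0 := by simpa using hl
        exact ⟨by simp, hadj b (by simp)⟩
      · obtain rfl : l = 0 := by simpa using hl
        exact ⟨by simp, hadj c (by simp)⟩
      · obtain rfl : l = 0 := by simpa using hl
        exact ⟨by simp, hadj d (by simp)⟩
      · obtain rfl : l = i := by simpa using hl
        refine ⟨by simp; omega, ?_⟩
        rw [hxi]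
        exact huy
  obtain ⟨T, hT, hcont⟩ := anyOf_eq_true.1 (allBelow_eq_true.1 sixVertexTrees_contained i hi)
  obtain ⟨x', hx'⟩ := (hemb.isCode (by simp)).exists_isEmbedding hcont
  have hforced := allOf_eq_true.1 sixVertexTrees_forced T hT
  rw [Bool.and_eq_true, Nat.beq_eq] at hforced
  have hcode := hx'.isCode (by omega)
  rw [hforced.1] at hcode
  have htodo : ∀ T ∈ sixVertexTrees, (∀ e ∈ T.2, e.1 < 6 ∧ e.2 < 6 ∧ e.1 ≠ e.2) ∧
      T.2.Pairwise fun e f => s(e.1, e.2) ≠ s(f.1, f.2) := by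
    decide
  refine hcode.of_forced h6 h10 (fun P hP y hy => ?_) (htodo T hT).1 (htodo T hT).2 (A := ∅)
    (by simp) (by simp) (by simp) hforced.2
  refine rainbowOn_of_savingPattern hG ?_ hy
  rw [List.mem_map] at hP ⊢
  obtain ⟨C, hC, rfl⟩ := hP
  exact ⟨C, List.mem_of_mem_take hC, rfl⟩

/-! ### Induction on the number of vertices -/

/-- Connected graphs of cyclomatic number at least five on more than five vertices have a rainbow
coloring with three colors fewer than vertices. -/
theorem Connected.rainbowOn_univ {V : Type*} [Fintype V] {G : SimpleGraph V}
    (hG : G.Connected) (h6 : 6 ≤ Fintype.card V)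
    (hcard : Fintype.card V + 4 ≤ Nat.card G.edgeSet) :
    G.RainbowOn Finset.univ (Fintype.card V - 3) := by
  classical
  obtain ⟨n, hn⟩ : ∃ n, n = Fintype.card V := ⟨_, rfl⟩
  induction n, (hn ▸ h6 : 6 ≤ n) using Nat.le_induction generalizing V with
  | base => exact hG.rainbowOn_of_card_eq_six hn.symm (by omega)
  | succ n hle ih =>
    by_cases htri : ∀ a b, G.Adj a b → ∃ z, G.Adj a z ∧ G.Adj b z
    · exact hG.rainbowOn_of_edges_in_triangles (by omega) (by omega) htri
    · push Not at htri
      obtain ⟨a, b, hab, hno⟩ := htri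
      have h1 := card_edgeSet_le_contract hab fun x hxa hxb => hno x hxa.symm hxb.symm
      have h2 : Fintype.card {v : V // v ≠ b} = n := by
        rw [Fintype.card_subtype_compl, Fintype.card_subtype_eq]
        omega
      have := RainbowOn.of_contract_univ hab
        (ih (hG.contract hab.ne) (by omega) (by omega) h2.symm)
      convert this using 1
      omega


/-! ### The graph `K_5 - e` -/

/-- A rainbow coloring with at most two colors gives the three pairs in a set of three vertices
colors that are not all equal, and differ on two pairs if the third pair is not an edge. -/
theorem IsRainbowColoring.exists_two_coloring {V : Type*} [Finite V] {G : SimpleGraph V} {q : ℕ}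
    {c : G.edgeSet → Fin q} (hc : G.IsRainbowColoring 3 c) (hq : q ≤ 2) :
    ∃ f : Sym2 V → ℕ, (∀ e, f e < 2) ∧ ∀ a b d, a ≠ b → a ≠ d → b ≠ d →
      ¬ (f s(a, b) = f s(a, d) ∧ f s(a, b) = f s(b, d)) ∧
      (¬ G.Adj a b → f s(a, d) ≠ f s(b, d)) := by
  classical
  -- The value 0 on non-edges is harmless: both claims follow from comparing two edges of the tree.
  refine ⟨fun e => if h : e ∈ G.edgeSet then c ⟨e, h⟩ else 0, fun e => ?_,
    fun a b d hab had hbd => ?_⟩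
  · beta_reduce
    split_ifs
    · exact (c _).2.trans_le hq
    · exact Nat.two_pos
  obtain ⟨T, hT, hS, hinj⟩ := hc {a, b, d} (Finset.card_eq_three.2 ⟨a, b, d, hab, had, hbd, rfl⟩)
  have ha := hS a (by simp)
  have hb := hS b (by simp)
  have hd := hS d (by simp)
  have := Fintype.ofFinite T.verts
  have hmap : ∀ e ∈ T.coe.edgeSet, Sym2.map Subtype.val e ∈ T.edgeSet := by
    intro e
    induction e using Sym2.ind with
    | _ u v => exact fun h => h
  have hedges : T.coe.edgeFinset.card ≤ 2 := by
    refine le_trans ?_ hq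
    rw [edgeFinset_card, ← Fintype.card_fin q]
    refine Fintype.card_le_of_injective
      (fun e => c ⟨Sym2.map Subtype.val e.1, T.edgeSet_subset (hmap e.1 e.2)⟩) fun e e' hee => ?_
    have := hinj _ _ (hmap e.1 e.2) (hmap e'.1 e'.2) hee
    exact Subtype.ext (Sym2.map.injective Subtype.val_injective (congrArg Subtype.val this))
  -- A tree with at most two edges has at most three vertices, so it spans exactly the triple.
  have hverts : ∀ w ∈ T.verts, w = a ∨ w = b ∨ w = d := by
    have hcard := hT.card_edgeFinset
    have hsub : ({a, b, d} : Finset V) ⊆ T.verts.toFinset := fun w hw =>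
      Set.mem_toFinset.2 (hS w hw)
    have heq := Finset.eq_of_subset_of_card_le hsub (by
      rw [Set.toFinset_card, Finset.card_eq_three.2 ⟨a, b, d, hab, had, hbd, rfl⟩]
      omega)
    intro w hw
    have : w ∈ ({a, b, d} : Finset V) := heq ▸ Set.mem_toFinset.2 hw
    simpa using this
  have hnbr : ∀ u (hu : u ∈ T.verts), ∃ w, T.Adj u w := by
    intro u hu
    have : Nontrivial T.verts := ⟨⟨⟨a, ha⟩, ⟨b, hb⟩, fun h => hab (congrArg Subtype.val h)⟩⟩
    obtain ⟨w, hw⟩ := hT.connected.preconnected.exists_adj_of_nontrivial ⟨u, hu⟩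
    exact ⟨w, hw⟩
  have hdiff : ∀ {u v u' v'}, T.Adj u v → T.Adj u' v' → s(u, v) ≠ s(u', v') →
      (if h : s(u, v) ∈ G.edgeSet then (c ⟨_, h⟩ : ℕ) else 0) ≠
        if h : s(u', v') ∈ G.edgeSet then (c ⟨_, h⟩ : ℕ) else 0 := by
    intro u v u' v' h h' hne heq
    have h1 : s(u, v) ∈ G.edgeSet := T.adj_sub h
    have h2 : s(u', v') ∈ G.edgeSet := T.adj_sub h'
    rw [dif_pos h1, dif_pos h2] at heq
    exact hne (congrArg Subtype.val (hinj ⟨_, h1⟩ ⟨_, h2⟩ h h' (Fin.ext heq)))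
  have h1 : s(a, b) ≠ s(a, d) := by simp [hbd, hab.symm, had]
  have h2 : s(a, b) ≠ s(b, d) := by simp [hab, had]
  have h3 : s(a, d) ≠ s(b, d) := by simp [hab, had]
  have hA : T.Adj a b ∨ T.Adj a d := by
    obtain ⟨w, hw⟩ := hnbr a ha
    rcases hverts w hw.snd_mem with rfl | rfl | rfl
    · exact absurd hw.adj_sub G.irrefl
    · exact Or.inl hw
    · exact Or.inr hw
  have hB : T.Adj a b ∨ T.Adj b d := by
    obtain ⟨w, hw⟩ := hnbr b hb
    rcases hverts w hw.snd_mem with rfl | rfl | rfl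
    · exact Or.inl hw.symm
    · exact absurd hw.adj_sub G.irrefl
    · exact Or.inr hw
  have hD : T.Adj a d ∨ T.Adj b d := by
    obtain ⟨w, hw⟩ := hnbr d hd
    rcases hverts w hw.snd_mem with rfl | rfl | rfl
    · exact Or.inl hw.symm
    · exact Or.inr hw.symm
    · exact absurd hw.adj_sub G.irrefl
  constructor
  · rintro ⟨e1, e2⟩
    rcases hA with hA | hA
    · rcases hD with hD | hD
      · exact hdiff hA hD h1 e1
      · exact hdiff hA hD h2 e2
    · rcases hB with hB | hB
      · exact hdiff hB hA h1 e1
      · exact hdiff hA hB h3 (e1.symm.trans e2)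
  · intro hnadj
    exact hdiff (hA.resolve_left fun h => hnadj (T.adj_sub h))
      (hB.resolve_left fun h => hnadj (T.adj_sub h)) h3

theorem completeFiveMinusEdge_adj {i j : Fin 5} :
    completeFiveMinusEdge.Adj i j ↔ i ≠ j ∧ s(i, j) ≠ s(0, 1) := by
  simp [completeFiveMinusEdge]

theorem rainbowIndex_eq_three_of_iso {V : Type*} [Fintype V] {G : SimpleGraph V}
    (φ : G ≃g completeFiveMinusEdge) : G.rainbowIndex 3 = 3 := by
  classical
  have hcard : Fintype.card V = 5 := Fintype.card_congr φ.toEquiv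
  have hinj := φ.symm.injective
  set z : Fin 5 → V := fun i => φ.symm i
  have hadj : ∀ i j, G.Adj (z i) (z j) ↔ i ≠ j ∧ s(i, j) ≠ s(0, 1) := fun i j =>
    φ.symm.map_adj_iff.trans completeFiveMinusEdge_adj
  -- Vertices 0 and 1 are the non-adjacent pair. Edges avoiding 4 get color 0; at vertex 4, those to
  -- 0 and 1 get color 1, those to 2 and 3 color 2.
  let P : ColoredPattern :=
    [[], [], [(0, 0), (1, 0)], [(0, 0), (1, 0), (2, 0)], [(0, 1), (1, 1), (2, 2), (3, 2)]]
  have hP : P.certifies 3 = true := by decide +kernel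
  have hemb : P.uncolor.IsEmbedding G fun k => z (Fin.ofNat 5 k) := by
    refine ⟨?_, ?_⟩
    · intro i hi j hj hij
      have hi : i < 5 := hi
      have hj : j < 5 := hj
      have := congrArg Fin.val (hinj hij)
      simpa [Nat.mod_eq_of_lt hi, Nat.mod_eq_of_lt hj] using this
    · simp only [hadj]
      decide
  have hinjOn := hemb.1
  have h3 := ColoredPattern.rainbowOn hP hemb
  have huniv : (Finset.range P.length).image (fun k => z (Fin.ofNat 5 k)) = Finset.univ := by
    rw [← Finset.card_eq_iff_eq_univ, Finset.card_image_of_injOn, Finset.card_range, hcard]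
    · rfl
    · simpa [Set.InjOn, P, ColoredPattern.uncolor] using hinjOn
  rw [huniv] at h3
  refine le_antisymm (h3.rainbowIndex_le (by norm_num)) ?_
  obtain ⟨c, hc⟩ := Nat.sInf_mem (s := {q : ℕ | ∃ c : G.edgeSet → Fin q, G.IsRainbowColoring 3 c})
    ⟨3, h3.exists_isRainbowColoring (by norm_num)⟩
  by_contra hlt
  obtain ⟨f, hf, htri⟩ := hc.exists_two_coloring (by unfold rainbowIndex at hlt; omega)
  have hne : ∀ {i j : Fin 5}, i ≠ j → z i ≠ z j := fun h h' => h (hinj h')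
  have hnadj : ¬ G.Adj (z 0) (z 1) := by simp [hadj]
  have key : ∀ i j k : Fin 5, i ≠ j → i ≠ k → j ≠ k →
      ¬ (f s(z i, z j) = f s(z i, z k) ∧ f s(z i, z j) = f s(z j, z k)) := fun i j k h1 h2 h3 =>
    (htri _ _ _ (hne h1) (hne h2) (hne h3)).1
  have key' : ∀ k : Fin 5, 0 ≠ k → 1 ≠ k → f s(z 0, z k) ≠ f s(z 1, z k) := fun k h1 h2 =>
    (htri _ _ _ (hne (by decide)) (hne h1) (hne h2)).2 hnadj
  have a2 := key' 2 (by decide) (by decide)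
  have a3 := key' 3 (by decide) (by decide)
  have a4 := key' 4 (by decide) (by decide)
  have b23 := key 0 2 3 (by decide) (by decide) (by decide)
  have b24 := key 0 2 4 (by decide) (by decide) (by decide)
  have b34 := key 0 3 4 (by decide) (by decide) (by decide)
  have c23 := key 1 2 3 (by decide) (by decide) (by decide)
  have c24 := key 1 2 4 (by decide) (by decide) (by decide)
  have c34 := key 1 3 4 (by decide) (by decide) (by decide)
  have d02 := hf s(z 0, z 2)
  have d03 := hf s(z 0, z 3)
  have d04 := hf s(z 0, z 4)
  have d12 := hf s(z 1, z 2)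
  have d13 := hf s(z 1, z 3)
  have d14 := hf s(z 1, z 4)
  have d23 := hf s(z 2, z 3)
  have d24 := hf s(z 2, z 4)
  have d34 := hf s(z 3, z 4)
  -- Two of the edges from 0 to 2, 3, 4 agree, say those to i and j. Those from 1 to i and j then
  -- both have the other color, so either color of ij closes a monochromatic triangle.
  omega

theorem nonempty_iso_completeFiveMinusEdge {V : Type*} [Fintype V] {G : SimpleGraph V}
    (h5 : Fintype.card V = 5) (h9 : Nat.card G.edgeSet = 9) :
    Nonempty (G ≃g completeFiveMinusEdge) := by
  classical
  obtain ⟨a, b, hab, hG⟩ : ∃ a b, a ≠ b ∧ ∀ u v, G.Adj u v ↔ u ≠ v ∧ s(u, v) ≠ s(a, b) := by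
    have h10 := card_edgeFinset_top_eq_card_choose_two (V := V)
    rw [h5, show Nat.choose 5 2 = 10 from rfl] at h10
    rw [Nat.card_eq_fintype_card, ← edgeFinset_card] at h9
    have hsub : G.edgeFinset ⊆ (⊤ : SimpleGraph V).edgeFinset := edgeFinset_mono le_top
    have hone : ((⊤ : SimpleGraph V).edgeFinset \ G.edgeFinset).card = 1 := by
      rw [Finset.card_sdiff_of_subset hsub]
      omega
    obtain ⟨e, he⟩ := Finset.card_eq_one.1 hone
    induction e using Sym2.ind with
    | _ a b =>
      have hmem : ∀ u v, (u ≠ v ∧ ¬ G.Adj u v) ↔ s(u, v) = s(a, b) := by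
        intro u v
        rw [← Finset.mem_singleton, ← he, Finset.mem_sdiff, mem_edgeFinset, mem_edgeFinset,
          mem_edgeSet, mem_edgeSet, top_adj]
      refine ⟨a, b, ((hmem a b).2 rfl).1, fun u v => ⟨fun h => ⟨h.ne, fun h' =>
        ((hmem u v).2 h').2 h⟩, fun h => ?_⟩⟩
      by_contra h'
      exact h.2 ((hmem u v).1 ⟨h.1, h'⟩)
  obtain ⟨e, ha, hb⟩ : ∃ e : V ≃ Fin 5, e a = 0 ∧ e b = 1 := by
    let e := Fintype.equivFinOfCardEq h5
    let e₁ := e.trans (Equiv.swap (e a) 0)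
    have h0 : e₁ a = 0 := by simp [e₁]
    refine ⟨e₁.trans (Equiv.swap (e₁ b) 1), ?_, by simp⟩
    rw [Equiv.trans_apply, h0]
    refine Equiv.swap_apply_of_ne_of_ne ?_ (by decide)
    rw [← h0]
    exact fun h => hab (e₁.injective h)
  refine ⟨⟨e, fun {u v} => ?_⟩⟩
  rw [completeFiveMinusEdge_adj, hG, ← ha, ← hb, e.injective.ne_iff, ← Sym2.map_mk, ← Sym2.map_mk,
    (Sym2.map.injective e.injective).ne_iff]

end SimpleGraph

/-! ### The characterization -/

theorem lemma3p4 {V : Type*} [Fintype V] (G : SimpleGraph V) (hconn : G.Connected)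
    (hcyc : G.cyclomaticNumber = 5) :
    (G.rainbowIndex 3 : ℤ) = (Fintype.card V : ℤ) - 2 ↔
      Nonempty (G ≃g SimpleGraph.completeFiveMinusEdge) := by
  have hcard : Nat.card G.edgeSet = Fintype.card V + 4 := by
    unfold SimpleGraph.cyclomaticNumber at hcyc
    rw [Nat.card_eq_fintype_card (α := V)] at hcyc
    omega
  constructor
  · intro h
    have hle := G.card_edgeSet_add_card_le (A := ∅) (by simp)
    rw [hcard, Finset.card_empty] at hle
    have h5 : 5 ≤ Fintype.card V := by
      -- Fewer than five vertices leave too few pairs for n + 4 edges.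
      by_contra! hlt
      generalize Fintype.card V = n at hle hlt
      interval_cases n <;> simp [Nat.choose] at hle
    rcases h5.eq_or_lt with h5 | h6
    · exact SimpleGraph.nonempty_iso_completeFiveMinusEdge h5.symm (by omega)
    · have := (hconn.rainbowOn_univ h6 hcard.ge).rainbowIndex_le (by omega)
      omega
  · rintro ⟨φ⟩
    rw [SimpleGraph.rainbowIndex_eq_three_of_iso φ, Fintype.card_congr φ.toEquiv, Fintype.card_fin]
    norm_num
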